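/- Let $\mathcal T$ be a triangulated category (with small Hom-sets) having all small coproducts, let $S$ be a (small) set of objects of $\mathcal T$, and let $\alpha$ be a regular cardinal such that $\mathcal T$ is $\alpha$-compactly generated and $S\subset\mathcal T^\alpha$. (Here $\mathcal T^\alpha$ is the class of $\alpha$-compact objects in the sense of Neeman, i.e. the largest $\alpha$-perfect class of $\alpha$-small objects, and $\mathcal T$ is $\alpha$-compactly generated if some small set of objects $G\subset\mathcal T^\alpha$ generates: $\mathrm{Hom}(\Sigma^n g,x)=0$ for all $g\in G$, $n\in\mathbb Z$ implies $x=0$.) Let $\langle S\rangle^{\le 0}$ be the smallest full subcategory of $\mathcal T$ containing $S$ and closed under $\Sigma$, extensions, direct summands and small coproducts. For classes of objects $A,B$ let $A*B$ be the class of all $y$ for which there is a distinguished triangle $a\to y\to b\to\Sigma a$ with $a\in A$, $b\in B$. For ordinals $1\le i\le\alpha$ define full subcategories $S(i)$ by transfinite recursion: $S(1)$ consists of the coproducts of fewer than $\alpha$ objects of $\bigcup_{j\ge0}\Sigma^jS$; $S(i+1)$ consists of the coproducts of fewer than $\alpha$ objects of $S(i)*S(i)$; and $S(i')=\bigcup_{1\le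 i<i'}S(i)$ for $i'$ a limit ordinal. For a class $P$ of objects let $\mathrm{Coprod}_1(P)$ be the class of all small coproducts of objects of $P$, and $\mathrm{Coprod}_{\ell+1}(P)=\mathrm{Coprod}_\ell(P)*\mathrm{Coprod}_1(P)$ for $\ell\ge1$. Then for every object $x\in\langle S\rangle^{\le0}$ there is a countable sequence $x_1\to x_2\to x_3\to\cdots$ in $\mathcal T$ such that $x_\ell\in\mathrm{Coprod}_\ell(S(\alpha))$ for every $\ell\ge1$ and $x$ is isomorphic to the homotopy colimit of the sequence, i.e. there is a distinguished triangle $\coprod_\ell x_\ell\xrightarrow{1-\mathrm{shift}}\coprod_\ell x_\ell\to x\to\Sigma\coprod_\ell x_\ell$. -/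

import Mathlib

open CategoryTheory CategoryTheory.Limits CategoryTheory.Pretriangulated

universe v u

namespace WellGenerated

section Coproducts

variable {C : Type u} [Category.{v} C]

/-- `t` is `α`-small: every morphism from `t` to a small coproduct factors through a
subcoproduct of fewer than `α` of the terms. -/
def IsSmallObject [HasCoproducts.{v} C] (α : Cardinal.{v}) (t : C) : Prop :=
  ∀ (Λ : Type v) (X : Λ → C) (f : t ⟶ ∐ X),
    ∃ (Λ' : Set Λ) (g : t ⟶ ∐ (fun l : Λ' => X l.1)),
      Cardinal.mk Λ' < α ∧ g ≫ Limits.Sigma.desc (fun l : Λ' => Limits.Sigma.ι X l.1) = f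

/-- The class `P` of objects is `α`-perfect: it contains a zero object, every morphism from an
object of `P` to a coproduct of fewer than `α` objects factors through a coproduct of morphisms
out of objects of `P`, and whenever a composite `k ⟶ ∐ kₗ ⟶ ∐ Xₗ` of this form vanishes,
this already happens after passing to suitable objects of `P` through which `kₗ ⟶ Xₗ` factors. -/
structure IsPerfectClass [HasZeroMorphisms C] [HasCoproducts.{v} C] (α : Cardinal.{v})
    (P : ObjectProperty C) : Prop where
  contains_zero : ∃ Z : C, IsZero Z ∧ P Z
  factor : ∀ (k : C), P k → ∀ (Λ : Type v), Cardinal.mk Λ < α →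
    ∀ (X : Λ → C) (f : k ⟶ ∐ X),
      ∃ (K : Λ → C) (g : k ⟶ ∐ K) (φ : ∀ l, K l ⟶ X l),
        (∀ l, P (K l)) ∧ g ≫ Limits.Sigma.map φ = f
  factor_zero : ∀ (k : C), P k → ∀ (Λ : Type v), Cardinal.mk Λ < α →
    ∀ (X K : Λ → C), (∀ l, P (K l)) → ∀ (g : k ⟶ ∐ K) (φ : ∀ l, K l ⟶ X l),
      g ≫ Limits.Sigma.map φ = 0 →
      ∃ (K' : Λ → C) (ψ : ∀ l, K l ⟶ K' l) (χ : ∀ l, K' l ⟶ X l),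
        (∀ l, P (K' l)) ∧ (∀ l, ψ l ≫ χ l = φ l) ∧ g ≫ Limits.Sigma.map ψ = 0

/-- The class `T^α` of `α`-compact objects: the largest `α`-perfect class of `α`-small objects,
that is, the union of all such classes. -/
def alphaCompact [HasZeroMorphisms C] [HasCoproducts.{v} C] (α : Cardinal.{v}) :
    ObjectProperty C :=
  fun t => ∃ P : ObjectProperty C,
    IsPerfectClass α P ∧ (∀ s, P s → IsSmallObject α s) ∧ P t

/-- The objects which are coproducts of fewer than `α` objects in `P`. -/
def coproductsLT (α : Cardinal.{v}) (P : ObjectProperty C) : ObjectProperty C :=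
  fun X => ∃ J : Type v, Cardinal.mk J < α ∧ P.colimitsOfShape (Discrete J) X

/-- The objects which are small coproducts of objects in `P`. -/
def coproducts (P : ObjectProperty C) : ObjectProperty C :=
  fun X => ∃ J : Type v, P.colimitsOfShape (Discrete J) X

end Coproducts

section Triangulated

variable {C : Type u} [Category.{v} C] [Preadditive C] [HasZeroObject C] [HasShift C ℤ]
  [∀ n : ℤ, (shiftFunctor C n).Additive] [Pretriangulated C]

/-- `C` is `α`-compactly generated: there is a small set `G` of `α`-compact objects such that an
object receiving only zero morphisms from all shifts of objects of `G` is zero. -/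
def IsAlphaCompactlyGenerated (C : Type u) [Category.{v} C] [Preadditive C] [HasShift C ℤ]
    [HasCoproducts.{v} C] (α : Cardinal.{v}) : Prop :=
  ∃ G : ObjectProperty C, ObjectProperty.Small.{v} G ∧ G ≤ alphaCompact α ∧
    ∀ x : C, (∀ (g : C), G g → ∀ (n : ℤ) (f : g⟦n⟧ ⟶ x), f = 0) → IsZero x

/-- `P` is a cocomplete pre-aisle: a full subcategory closed under positive suspension,
extensions, direct summands and small coproducts. -/
structure IsCocompletePreaisle (P : ObjectProperty C) : Prop where
  suspension : ∀ X : C, P X → P (X⟦(1 : ℤ)⟧)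
  extension : P.extensionProduct P ≤ P
  summand : P.IsStableUnderRetracts
  coproduct : coproducts P ≤ P

/-- `⟨S⟩^{≤ 0}`: the smallest cocomplete pre-aisle containing `S`. -/
def preaisle (S : ObjectProperty C) : ObjectProperty C :=
  fun X => ∀ P : ObjectProperty C, IsCocompletePreaisle P → S ≤ P → P X

/-- The union of the classes `Σ^j S`, for `j ≥ 0` (up to isomorphism). -/
def suspensions (S : ObjectProperty C) : ObjectProperty C :=
  fun X => ∃ (j : ℕ) (s : C), S s ∧ Nonempty (X ≅ s⟦(j : ℤ)⟧)

open Classical in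
/-- The classes `S(i)`, by transfinite recursion on the ordinal `i`. The recursion starts at
`i = 1`; the value at `0` is the empty class, so that it does not contribute to any union. -/
noncomputable def stage (α : Cardinal.{v}) (S : ObjectProperty C) (i : Ordinal.{v}) :
    ObjectProperty C :=
  Ordinal.limitRecOn i ⊥
    (fun j Sj => if j = 0 then coproductsLT α (suspensions S)
      else coproductsLT α (Sj.extensionProduct Sj))
    (fun j _ ih X => ∃ (i' : Ordinal.{v}) (h : i' < j), ih i' h X)

theorem stage_one (α : Cardinal.{v}) (S : ObjectProperty C) :
    stage α S 1 = coproductsLT α (suspensions S) := by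
  have h : stage α S (0 + 1) = coproductsLT α (suspensions S) := by
    unfold stage
    rw [Ordinal.limitRecOn_add_one, if_pos rfl]
  rwa [zero_add] at h

theorem stage_add_one (α : Cardinal.{v}) (S : ObjectProperty C) (i : Ordinal.{v}) (hi : i ≠ 0) :
    stage α S (i + 1) = coproductsLT α ((stage α S i).extensionProduct (stage α S i)) := by
  unfold stage
  rw [Ordinal.limitRecOn_add_one, if_neg hi]

theorem stage_limit (α : Cardinal.{v}) (S : ObjectProperty C) (i : Ordinal.{v})
    (hi : Order.IsSuccLimit i) (X : C) :
    stage α S i X ↔ ∃ i' : Ordinal.{v}, 1 ≤ i' ∧ i' < i ∧ stage α S i' X := by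
  have h : stage α S i X ↔ ∃ (i' : Ordinal.{v}) (_ : i' < i), stage α S i' X := by
    unfold stage
    rw [Ordinal.limitRecOn_limit _ _ _ _ hi]
  rw [h]
  constructor
  · rintro ⟨i', hi', hX⟩
    refine ⟨i', Order.one_le_iff_pos.2 (pos_iff_ne_zero.2 ?_), hi', hX⟩
    rintro rfl
    unfold stage at hX
    rw [Ordinal.limitRecOn_zero] at hX
    exact hX
  · rintro ⟨i', -, hi', hX⟩
    exact ⟨i', hi', hX⟩

/-- The class `S(α)`. -/
noncomputable def transfiniteClosure (α : Cardinal.{v}) (S : ObjectProperty C) :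
    ObjectProperty C :=
  stage α S α.ord

/-- The class `Coprod_ℓ(P)`, for `ℓ ≥ 1`: `Coprod_1(P)` consists of the coproducts of objects
of `P`, and `Coprod_{ℓ+1}(P) = Coprod_ℓ(P) * Coprod_1(P)`. The value at `ℓ = 0` is the empty
class and is not used. -/
def coprodExt (P : ObjectProperty C) : ℕ → ObjectProperty C
  | 0 => ⊥
  | 1 => coproducts P
  | n + 2 => (coprodExt P (n + 1)).extensionProduct (coproducts P)

/-- `x` is a homotopy colimit of the sequence `X 0 ⟶ X 1 ⟶ ⋯`: it is the third vertex of a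
distinguished triangle on the morphism `1 - shift` of `∐ X n`. -/
def IsHomotopyColimit (X : ℕ → C) (f : ∀ n, X n ⟶ X (n + 1)) (x : C) : Prop :=
  ∃ (c : Cofan X) (hc : IsColimit c) (p : c.pt ⟶ x) (δ : x ⟶ c.pt⟦(1 : ℤ)⟧),
    Triangle.mk (Cofan.IsColimit.desc hc (fun n => c.inj n - f n ≫ c.inj (n + 1))) p δ
      ∈ distTriang C

end Triangulated

end WellGenerated

set_option linter.unusedSectionVars false

/-! Let `D` be the closure of the `α`-compact objects under shifts, cones and coproducts of fewer
than `α` terms, and write `T` for `S(α)`. The argument tests everything on morphisms out of objects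
of `D`.

Smallness and perfectness make every map from an `α`-compact object to a coproduct factor through a
coproduct of maps out of objects of `D`, fewer than `α` of them nonzero. This property survives the
operations defining `D` (`compactClosure.hasSparseFactorizations`), so no closure properties of the
`α`-compact class itself are needed.

The objects `x` such that every map from `D` to `x` factors through an object of `T` form a
cocomplete pre-aisle (`isCocompletePreaisle_factorsThrough`). It contains `S`, hence all of
`preaisle S`. Since `T` is essentially small, each object of the pre-aisle receives a map from a
coproduct of objects of `T` through which every map from `D` lifts (`exists_cover`).

Covering `x`, and then repeatedly covering the cone of `X n ⟶ x`, gives a sequence over `x` in which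
each transition map annihilates what `D` sees of the kernel of `X n ⟶ x`
(`exists_approximating_sequence`). Seen from `D`, the homotopy colimit then agrees with `x`; as `D`
generates, the two are isomorphic (`isHomotopyColimit_of_approximating_sequence`). -/

namespace WellGenerated

/-! ### Sparse factorizations of maps into coproducts. -/

section SparseFactorizations

variable {C : Type u} [Category.{v} C] [HasCoproducts.{v} C]

/-- Every morphism from `k` to a small coproduct `∐ X` factors through a coproduct of morphisms
`K l ⟶ X l`, where the `K l` satisfy `D` and fewer than `α` of them are nonzero. -/
def HasSparseFactorizations (D : ObjectProperty C) (α : Cardinal.{v}) : ObjectProperty C :=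
  fun k => ∀ (Λ : Type v) (X : Λ → C) (f : k ⟶ ∐ X),
    ∃ (K : Λ → C) (φ : ∀ l, K l ⟶ X l) (g : k ⟶ ∐ K),
      (∀ l, D (K l)) ∧ Cardinal.mk {l // ¬ IsZero (K l)} < α ∧ g ≫ Limits.Sigma.map φ = f

variable {D : ObjectProperty C} {α : Cardinal.{v}}

theorem HasSparseFactorizations.of_iso {k k' : C} (e : k ≅ k')
    (hk : HasSparseFactorizations D α k) : HasSparseFactorizations D α k' := by
  intro Λ X f
  obtain ⟨K, φ, g, h1, h2, h3⟩ := hk Λ X (e.hom ≫ f)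
  exact ⟨K, φ, e.inv ≫ g, h1, h2, by simp [h3]⟩

theorem HasSparseFactorizations.exists_cofan {k : C} (hk : HasSparseFactorizations D α k)
    {Λ : Type v} {X : Λ → C} {c : Cofan X} (hc : IsColimit c) (f : k ⟶ c.pt) :
    ∃ (K : Λ → C) (φ : ∀ l, K l ⟶ X l) (g : k ⟶ ∐ K),
      (∀ l, D (K l)) ∧ Cardinal.mk {l // ¬ IsZero (K l)} < α ∧
        g ≫ Limits.Sigma.desc (fun l => φ l ≫ c.inj l) = f := by
  obtain ⟨K, φ, g, h1, h2, h3⟩ := hk Λ X (f ≫ Cofan.IsColimit.desc hc (Limits.Sigma.ι X))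
  refine ⟨K, φ, g, h1, h2, ?_⟩
  have e : Limits.Sigma.desc (fun l => φ l ≫ c.inj l) =
      Limits.Sigma.map φ ≫ Limits.Sigma.desc c.inj := by
    ext l; simp
  rw [e, ← Category.assoc, h3, Category.assoc]
  convert Category.comp_id f
  exact Cofan.IsColimit.hom_ext hc _ _ fun l => by simp

theorem exists_sparse_of_cofan {k : C} {Λ : Type v} {X K : Λ → C} {d : Cofan K}
    (hd : IsColimit d) (φ : ∀ l, K l ⟶ X l) (g : k ⟶ d.pt) (f : k ⟶ ∐ X)
    (hf : g ≫ Cofan.IsColimit.desc hd (fun l => φ l ≫ Limits.Sigma.ι X l) = f) :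
    (g ≫ Cofan.IsColimit.desc hd (Limits.Sigma.ι K)) ≫ Limits.Sigma.map φ = f := by
  rw [← hf, Category.assoc]
  congr 1
  exact Cofan.IsColimit.hom_ext hd _ _ fun l => by simp

variable [HasZeroMorphisms C]

theorem isZero_sigma {Λ : Type v} (K : Λ → C) (h : ∀ l, IsZero (K l)) : IsZero (∐ K) := by
  rw [IsZero.iff_id_eq_zero]
  exact Limits.Sigma.hom_ext _ _ fun l => (h l).eq_of_src _ _

/-- A factorization through a coproduct of fewer than `α` objects mapping to the summands,
indexed arbitrarily, yields a sparse one. -/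
theorem exists_sparse_of_index (hD : ∀ (J : Type v) (K : J → C), Cardinal.mk J < α →
      (∀ j, D (K j)) → D (∐ K)) {k : C} {Λ J : Type v} (hJ : Cardinal.mk J < α)
    {X : Λ → C} (a : J → Λ) (K : J → C) (hK : ∀ j, D (K j)) (φ : ∀ j, K j ⟶ X (a j))
    (g : k ⟶ ∐ K) :
    ∃ (K' : Λ → C) (φ' : ∀ l, K' l ⟶ X l) (g' : k ⟶ ∐ K'),
      (∀ l, D (K' l)) ∧ Cardinal.mk {l // ¬ IsZero (K' l)} < α ∧
        g' ≫ Limits.Sigma.map φ' =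
          g ≫ Limits.Sigma.desc (fun j => φ j ≫ Limits.Sigma.ι X (a j)) := by
  -- The map `a` need not be injective, so the `K j` are grouped along its fibres; only `l` in the
  -- image of `a` can give a nonzero term.
  refine ⟨fun l => ∐ fun p : {j // a j = l} => K p.1,
    fun l => Limits.Sigma.desc fun p => φ p.1 ≫ eqToHom (by rw [p.2]),
    g ≫ Limits.Sigma.desc (fun j => Limits.Sigma.ι (fun p : {j' // a j' = a j} => K p.1) ⟨j, rfl⟩ ≫
      Limits.Sigma.ι (fun l => ∐ fun p : {j // a j = l} => K p.1) (a j)), ?_, ?_, ?_⟩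
  · exact fun l => hD _ _ ((Cardinal.mk_subtype_le _).trans_lt hJ) fun p => hK _
  · have h : ∀ l : {l // ¬ IsZero (∐ fun p : {j // a j = l} => K p.1)}, ∃ j, a j = l.1 := by
      intro l
      by_contra h
      push Not at h
      exact l.2 (isZero_sigma _ fun p => (h p.1 p.2).elim)
    choose b hb using h
    refine lt_of_le_of_lt (Cardinal.mk_le_of_injective (f := b) fun l l' hl => ?_) hJ
    rw [Subtype.ext_iff, ← hb l, ← hb l', hl]
  · rw [Category.assoc]
    congr 1
    ext j
    simp

/-- Factor on each summand and take coproducts over `J` termwise. By regularity, the union of fewer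
than `α` supports of size less than `α` again has size less than `α`. -/
theorem HasSparseFactorizations.sigma (hα : α.IsRegular)
    (hD : ∀ (J : Type v) (K : J → C), Cardinal.mk J < α → (∀ j, D (K j)) → D (∐ K))
    {J : Type v} (hJ : Cardinal.mk J < α) (k : J → C)
    (hk : ∀ j, HasSparseFactorizations D α (k j)) : HasSparseFactorizations D α (∐ k) := by
  intro Λ X f
  choose K φ g h1 h2 h3 using fun j => hk j Λ X (Limits.Sigma.ι k j ≫ f)
  refine ⟨fun l => ∐ fun j => K j l, fun l => Limits.Sigma.desc fun j => φ j l,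
    Limits.Sigma.desc fun j => g j ≫ Limits.Sigma.map fun l => Limits.Sigma.ι (fun j => K j l) j,
    fun l => hD _ _ hJ fun j => h1 j l, ?_, ?_⟩
  · have h := (Cardinal.card_iUnion_lt_iff_forall_of_isRegular
      (t := fun j => {l | ¬ IsZero (K j l)}) hα hJ).2 h2
    refine lt_of_le_of_lt (Cardinal.mk_le_mk_of_subset
      (s := {l | ¬ IsZero (∐ fun j => K j l)}) fun l hl => ?_) h
    by_contra hl'
    simp only [Set.mem_iUnion, Set.mem_ofPred_eq, not_exists, not_not] at hl'
    exact hl (isZero_sigma _ hl')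
  · ext j
    rw [← h3]
    simp only [colimit.ι_desc_assoc, Cofan.mk_pt, Cofan.mk_ι_app, Category.assoc]
    congr 1
    ext l
    simp

end SparseFactorizations

section Preadditive

variable {C : Type u} [Category.{v} C] [Preadditive C] [HasCoproducts.{v} C]
  {D : ObjectProperty C} {α : Cardinal.{v}}

theorem exists_sparse_add [HasBinaryBiproducts C] (hα : Cardinal.aleph0 ≤ α)
    (hD : ∀ X Y, D X → D Y → D (X ⊞ Y)) {k : C} {Λ : Type v} {X K L : Λ → C}
    (hK : ∀ l, D (K l)) (hL : ∀ l, D (L l)) (hK' : Cardinal.mk {l // ¬ IsZero (K l)} < α)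
    (hL' : Cardinal.mk {l // ¬ IsZero (L l)} < α) (φ : ∀ l, K l ⟶ X l) (ψ : ∀ l, L l ⟶ X l)
    (g : k ⟶ ∐ K) (h : k ⟶ ∐ L) :
    ∃ (M : Λ → C) (χ : ∀ l, M l ⟶ X l) (g' : k ⟶ ∐ M),
      (∀ l, D (M l)) ∧ Cardinal.mk {l // ¬ IsZero (M l)} < α ∧
        g' ≫ Limits.Sigma.map χ = g ≫ Limits.Sigma.map φ + h ≫ Limits.Sigma.map ψ := by
  refine ⟨fun l => K l ⊞ L l, fun l => biprod.desc (φ l) (ψ l),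
    g ≫ Limits.Sigma.map (fun _ => biprod.inl) + h ≫ Limits.Sigma.map (fun _ => biprod.inr),
    fun l => hD _ _ (hK l) (hL l), ?_, ?_⟩
  · refine lt_of_le_of_lt (Cardinal.mk_le_mk_of_subset (s := {l | ¬ IsZero (K l ⊞ L l)})
      (t := {l | ¬ IsZero (K l)} ∪ {l | ¬ IsZero (L l)}) fun l hl => ?_)
      (lt_of_le_of_lt (Cardinal.mk_union_le _ _) (Cardinal.add_lt_of_lt hα hK' hL'))
    by_contra hl'
    simp only [Set.mem_union, Set.mem_ofPred_eq, not_or, not_not] at hl'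
    exact hl ((biprod_isZero_iff _ _).2 hl')
  · rw [Preadditive.add_comp, Category.assoc, Category.assoc]
    congr 2 <;> (ext l; simp)

end Preadditive

/-! ### Sparse factorizations under shifts and cones. -/

section Triangulated

variable {C : Type u} [Category.{v} C] [Preadditive C] [HasZeroObject C] [HasShift C ℤ]
  [∀ n : ℤ, (shiftFunctor C n).Additive] [Pretriangulated C] [HasCoproducts.{v} C]

section

omit [HasCoproducts.{v} C]

variable {X Y Z : C} {f : X ⟶ Y} {g : Y ⟶ Z} {h : Z ⟶ X⟦(1 : ℤ)⟧}
  (hT : Triangle.mk f g h ∈ distTriang C)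
include hT

theorem distTriang_comp₁₂ : f ≫ g = 0 := comp_distTriang_mor_zero₁₂ _ hT

theorem distTriang_comp₂₃ : g ≫ h = 0 := comp_distTriang_mor_zero₂₃ _ hT

theorem distTriang_comp₃₁ : h ≫ f⟦(1 : ℤ)⟧' = 0 := comp_distTriang_mor_zero₃₁ _ hT

theorem distTriang_lift₁ {k : C} (u : k ⟶ Y) (hu : u ≫ g = 0) : ∃ u' : k ⟶ X, u' ≫ f = u := by
  obtain ⟨u', hu'⟩ := Triangle.coyoneda_exact₂ _ hT u hu
  exact ⟨u', hu'.symm⟩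

theorem distTriang_lift₂ {k : C} (u : k ⟶ Z) (hu : u ≫ h = 0) : ∃ u' : k ⟶ Y, u' ≫ g = u := by
  obtain ⟨u', hu'⟩ := Triangle.coyoneda_exact₃ _ hT u hu
  exact ⟨u', hu'.symm⟩

theorem distTriang_desc₃ {k : C} (u : Y ⟶ k) (hu : f ≫ u = 0) : ∃ u' : Z ⟶ k, g ≫ u' = u := by
  obtain ⟨u', hu'⟩ := Triangle.yoneda_exact₂ _ hT u hu
  exact ⟨u', hu'.symm⟩

theorem distTriang_desc₄ {k : C} (u : Z ⟶ k) (hu : g ≫ u = 0) :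
    ∃ u' : X⟦(1 : ℤ)⟧ ⟶ k, h ≫ u' = u := by
  obtain ⟨u', hu'⟩ := Triangle.yoneda_exact₃ _ hT u hu
  exact ⟨u', hu'.symm⟩

variable {X' Y' Z' : C} {f' : X' ⟶ Y'} {g' : Y' ⟶ Z'} {h' : Z' ⟶ X'⟦(1 : ℤ)⟧}
  (hT' : Triangle.mk f' g' h' ∈ distTriang C)
include hT'

theorem distTriang_map₃ (a : X ⟶ X') (b : Y ⟶ Y') (comm : f ≫ b = a ≫ f') :
    ∃ c : Z ⟶ Z', g ≫ c = b ≫ g' ∧ h ≫ a⟦(1 : ℤ)⟧' = c ≫ h' :=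
  complete_distinguished_triangle_morphism _ _ hT hT' a b comm

theorem distTriang_map₂ (a : X ⟶ X') (c : Z ⟶ Z') (comm : h ≫ a⟦(1 : ℤ)⟧' = c ≫ h') :
    ∃ b : Y ⟶ Y', f ≫ b = a ≫ f' ∧ g ≫ c = b ≫ g' :=
  complete_distinguished_triangle_morphism₂ _ _ hT hT' a c comm

end

/-- A coproduct of weak kernels coming from distinguished triangles is a weak kernel. -/
theorem exists_lift_sigma {Λ : Type v} {X Y Z : Λ → C} {f : ∀ l, X l ⟶ Y l} {g : ∀ l, Y l ⟶ Z l}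
    {h : ∀ l, Z l ⟶ (X l)⟦(1 : ℤ)⟧} (hT : ∀ l, Triangle.mk (f l) (g l) (h l) ∈ distTriang C)
    {k : C} (u : k ⟶ ∐ Y) (hu : u ≫ Limits.Sigma.map g = 0) :
    ∃ u' : k ⟶ ∐ X, u' ≫ Limits.Sigma.map f = u := by
  -- The coproduct triangle need not be known to be distinguished: it is enough that `∐ Y ⟶ W`
  -- factors through `∐ g`, which follows from a map of triangles on each summand.
  obtain ⟨W, b, c, hW⟩ := distinguished_cocone_triangle (Limits.Sigma.map f)
  choose r hr _ using fun l => distTriang_map₃ (hT l) hW (Limits.Sigma.ι X l)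
    (Limits.Sigma.ι Y l) (by simp)
  refine distTriang_lift₁ hW u ?_
  have e : b = Limits.Sigma.map g ≫ Limits.Sigma.desc r := by
    ext l
    simpa using (hr l).symm
  rw [e, reassoc_of% hu, zero_comp]

variable {D : ObjectProperty C} {α : Cardinal.{v}}

/-- Transpose a map `F k ⟶ ∐ X` to `k ⟶ ∐ G X`, factor there, and transpose back. Sparsity survives
because `F` preserves zero objects. -/
theorem HasSparseFactorizations.map_of_adjunction {F G : C ⥤ C} (adj : F ⊣ G)
    [F.PreservesZeroMorphisms] [PreservesColimitsOfSize.{v, v} G]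
    (hD : ∀ X, D X → D (F.obj X)) {k : C} (hk : HasSparseFactorizations D α k) :
    HasSparseFactorizations D α (F.obj k) := by
  intro Λ X f
  have : PreservesColimitsOfSize.{v, v} F := adj.leftAdjoint_preservesColimits
  let hc := isColimitCofanMkObjOfIsColimit G _ _ (coproductIsCoproduct X)
  obtain ⟨K, φ, g, h1, h2, h3⟩ := hk.exists_cofan hc (adj.homEquiv _ _ f)
  let hd := isColimitCofanMkObjOfIsColimit F _ _ (coproductIsCoproduct K)
  refine ⟨fun l => F.obj (K l), fun l => (adj.homEquiv _ _).symm (φ l), _,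
    fun l => hD _ (h1 l), ?_, exists_sparse_of_cofan hd _ (F.map g) f ?_⟩
  · exact lt_of_le_of_lt (Cardinal.mk_le_mk_of_subset (s := {l | ¬ IsZero (F.obj (K l))})
      (t := {l | ¬ IsZero (K l)}) fun l hl hl' => hl (F.map_isZero hl')) h2
  · apply (adj.homEquiv _ _).injective
    rw [← h3, Adjunction.homEquiv_naturality_left]
    congr 1
    ext l
    rw [← Adjunction.homEquiv_naturality_left]
    have := Cofan.IsColimit.fac hd
      (fun l => (adj.homEquiv (K l) (X l)).symm (φ l) ≫ Limits.Sigma.ι X l) l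
    rw [cofan_mk_inj] at this
    erw [this]
    rw [Adjunction.homEquiv_naturality_right]
    simp

theorem HasSparseFactorizations.shift (hD : ∀ X (n : ℤ), D X → D (X⟦n⟧)) {k : C}
    (hk : HasSparseFactorizations D α k) (n : ℤ) : HasSparseFactorizations D α (k⟦n⟧) :=
  have : PreservesColimitsOfSize.{v, v} (shiftEquiv C n).inverse := inferInstance
  have : (shiftEquiv C n).functor.PreservesZeroMorphisms :=
    inferInstanceAs (shiftFunctor C n).PreservesZeroMorphisms
  hk.map_of_adjunction (shiftEquiv C n).toAdjunction fun X => hD X n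

/-- The factorization is first found after restriction to `X₂`, then enlarged so that it extends
over `X₃`. The extension agrees with `f` on `X₂` only; the error comes from `X₁⟦1⟧`, where the
hypothesis on `X₁` applies again, and the two factorizations are added. -/
theorem HasSparseFactorizations.cone (hα : Cardinal.aleph0 ≤ α) [D.IsTriangulated]
    [D.IsClosedUnderIsomorphisms] {X₁ X₂ X₃ : C} {a : X₁ ⟶ X₂} {b : X₂ ⟶ X₃}
    {c : X₃ ⟶ X₁⟦(1 : ℤ)⟧} (hT : Triangle.mk a b c ∈ distTriang C)
    (h₁ : HasSparseFactorizations D α X₁) (h₂ : HasSparseFactorizations D α X₂) :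
    HasSparseFactorizations D α X₃ := by
  intro Λ X f
  obtain ⟨K, φ, g, hK, hK', hg⟩ := h₂ Λ X (b ≫ f)
  choose F j δ hF using fun l => distinguished_cocone_triangle₁ (φ l)
  obtain ⟨h, hh⟩ := exists_lift_sigma hF (a ≫ g) (by
    rw [Category.assoc, hg, reassoc_of% (distTriang_comp₁₂ hT), zero_comp])
  obtain ⟨L, θ, h', hL, hL', hh'⟩ := h₁ Λ F h
  -- Passing from `K l` to the cone `M l` of `L l ⟶ F l ⟶ K l` kills `a ≫ g`, and `φ l` still
  -- extends to `M l` because `F l` is the fibre of `φ l`.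
  choose M hM r s hr using fun l => D.distinguished_cocone_triangle (θ l ≫ j l) (hL l) (hK l)
  choose χ hχ using fun l => distTriang_desc₃ (hr l) (φ l) (by
    rw [Category.assoc, distTriang_comp₁₂ (hF l), comp_zero])
  have hM' : Cardinal.mk {l // ¬ IsZero (M l)} < α := by
    refine lt_of_le_of_lt (Cardinal.mk_le_mk_of_subset (s := {l | ¬ IsZero (M l)})
      (t := {l | ¬ IsZero (L l)} ∪ {l | ¬ IsZero (K l)}) fun l hl => ?_)
      (lt_of_le_of_lt (Cardinal.mk_union_le _ _) (Cardinal.add_lt_of_lt hα hL' hK'))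
    by_contra hl'
    simp only [Set.mem_union, Set.mem_ofPred_eq, not_or, not_not] at hl'
    exact hl (Triangle.isZero₃_of_isZero₁₂ _ (hr l) hl'.1 hl'.2)
  obtain ⟨t, ht⟩ := distTriang_desc₃ hT (g ≫ Limits.Sigma.map r) (by
    rw [← Category.assoc, ← hh, ← hh', Category.assoc, Category.assoc]
    convert comp_zero
    ext l
    have := distTriang_comp₁₂ (hr l) =≫ Limits.Sigma.ι M l
    simpa using this)
  obtain ⟨w, hw⟩ := distTriang_desc₄ hT (f - t ≫ Limits.Sigma.map χ) (by
    rw [Preadditive.comp_sub, ← hg, ← Category.assoc, ht, Category.assoc, sub_eq_zero]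
    congr 1
    ext l
    simp [reassoc_of% (hχ l)])
  obtain ⟨N, ψ, g', hN, hN', hg'⟩ := h₁.shift (fun X n => D.le_shift n X) 1 Λ X w
  obtain ⟨M', χ', g'', hM1, hM2, hM3⟩ := exists_sparse_add hα
    (fun X Y hX hY => D.ext_of_isTriangulatedClosed₂ _
      (binaryBiproductTriangle_distinguished X Y) hX hY) hM hN hM' hN' χ ψ t (c ≫ g')
  refine ⟨M', χ', g'', hM1, hM2, ?_⟩
  rw [hM3, Category.assoc, hg', hw]
  abel

end Triangulated

/-! ### The triangulated closure of the `α`-compact objects. -/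

section CompactClosure

variable {C : Type u} [Category.{v} C] [Preadditive C] [HasZeroObject C] [HasShift C ℤ]
  [∀ n : ℤ, (shiftFunctor C n).Additive] [Pretriangulated C] [HasCoproducts.{v} C]

variable (C) in
/-- The closure of the class of `α`-compact objects under isomorphisms, shifts, cones and
coproducts of fewer than `α` objects. -/
inductive compactClosure (α : Cardinal.{v}) : ObjectProperty C
  | of (X : C) (h : alphaCompact α X) : compactClosure α X
  | iso {X Y : C} (e : X ≅ Y) (h : compactClosure α X) : compactClosure α Y
  | shift (X : C) (n : ℤ) (h : compactClosure α X) : compactClosure α (X⟦n⟧)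
  | cone {X Y Z : C} (f : X ⟶ Y) (g : Y ⟶ Z) (h : Z ⟶ X⟦(1 : ℤ)⟧)
      (hT : Triangle.mk f g h ∈ distTriang C) (hX : compactClosure α X)
      (hY : compactClosure α Y) : compactClosure α Z
  | sigma (J : Type v) (K : J → C) (hJ : Cardinal.mk J < α) (hK : ∀ j, compactClosure α (K j)) :
      compactClosure α (∐ K)

variable {α : Cardinal.{v}}

instance : (compactClosure C α).IsClosedUnderIsomorphisms where
  of_iso e h := h.iso e

instance : (compactClosure C α).IsStableUnderShift ℤ where
  isStableUnderShiftBy n := { le_shift := fun X h => h.shift X n }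

instance : (compactClosure C α).IsTriangulatedClosed₃ :=
  .mk' fun T hT h₁ h₂ => .cone T.mor₁ T.mor₂ T.mor₃ hT h₁ h₂

theorem compactClosure_isTriangulated (hα : α.IsRegular) : (compactClosure C α).IsTriangulated :=
  have : (compactClosure C α).IsTriangulatedClosed₂ := .of_isTriangulatedClosed₃
  { exists_zero := ⟨_, isZero_sigma (PEmpty.elim.{u+1, v+1} : PEmpty → C) (fun l => l.elim),
      .sigma _ _ (by simpa using hα.pos) (fun l => l.elim)⟩ }

/-- Smallness cuts the coproduct down to fewer than `α` terms, and then perfectness factors the map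
termwise. -/
theorem alphaCompact.hasSparseFactorizations {D : ObjectProperty C}
    (hD : ∀ (J : Type v) (K : J → C), Cardinal.mk J < α → (∀ j, D (K j)) → D (∐ K))
    (hD' : alphaCompact α ≤ D) {t : C} (ht : alphaCompact α t) :
    HasSparseFactorizations D α t := by
  obtain ⟨P, hP, hPs, hPt⟩ := ht
  intro Λ X f
  obtain ⟨Λ', g, hΛ, rfl⟩ := hPs t hPt Λ X f
  obtain ⟨K, g', φ, hK, rfl⟩ := hP.factor t hPt Λ' hΛ _ g
  obtain ⟨K', φ', g'', h1, h2, h3⟩ := exists_sparse_of_index hD hΛ (X := X)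
    (fun l : Λ' => l.1) K (fun l => hD' _ ⟨P, hP, hPs, hK l⟩) φ g'
  refine ⟨K', φ', g'', h1, h2, ?_⟩
  rw [h3, Category.assoc]
  congr 1
  ext l
  simp

theorem compactClosure.hasSparseFactorizations (hα : α.IsRegular) {k : C}
    (hk : compactClosure C α k) : HasSparseFactorizations (compactClosure C α) α k := by
  have := compactClosure_isTriangulated (C := C) hα
  induction hk with
  | of X h => exact h.hasSparseFactorizations .sigma .of
  | iso e _ ih => exact ih.of_iso e
  | shift X n _ ih => exact ih.shift (fun X n hX => hX.shift X n) n
  | cone f g h hT _ _ ih₁ ih₂ => exact ih₁.cone hα.aleph0_le hT ih₂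
  | sigma J K hJ _ ih => exact .sigma hα .sigma hJ K ih

/-- If all morphisms from objects of `D` lift along each `p l`, then they lift along `∐ p`. -/
theorem exists_lift_sigma_of_surjective {D : ObjectProperty C} {k : C}
    (hk : HasSparseFactorizations D α k) {Λ : Type v} {X Y : Λ → C} (p : ∀ l, X l ⟶ Y l)
    (hp : ∀ l K (_ : D K) (u : K ⟶ Y l), ∃ u' : K ⟶ X l, u' ≫ p l = u) (u : k ⟶ ∐ Y) :
    ∃ u' : k ⟶ ∐ X, u' ≫ Limits.Sigma.map p = u := by
  obtain ⟨K, φ, g, hK, -, rfl⟩ := hk Λ Y u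
  choose φ' hφ' using fun l => hp l (K l) (hK l) (φ l)
  refine ⟨g ≫ Limits.Sigma.map φ', ?_⟩
  rw [Category.assoc]
  congr 1
  ext l
  simp [reassoc_of% (hφ' l)]

/-- If each `q l` annihilates the morphisms from objects of `D` annihilated by `p l`, then `∐ q`
annihilates those annihilated by `∐ p`. -/
theorem comp_sigmaMap_eq_zero {D : ObjectProperty C} {k : C}
    (hk : HasSparseFactorizations D α k) {Λ : Type v} {X Y Z : Λ → C} (p : ∀ l, X l ⟶ Y l)
    (q : ∀ l, X l ⟶ Z l) (hq : ∀ l K (_ : D K) (u : K ⟶ X l), u ≫ p l = 0 → u ≫ q l = 0)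
    (u : k ⟶ ∐ X) (hu : u ≫ Limits.Sigma.map p = 0) : u ≫ Limits.Sigma.map q = 0 := by
  -- Lifting `u` to the coproduct of the fibres before factoring guarantees that each `K l ⟶ X l` is
  -- itself annihilated by `p l`.
  choose F j δ hF using fun l => distinguished_cocone_triangle₁ (p l)
  obtain ⟨u', rfl⟩ := exists_lift_sigma hF u hu
  obtain ⟨K, φ, g, hK, -, rfl⟩ := hk Λ F u'
  rw [Category.assoc, Category.assoc]
  convert comp_zero
  ext l
  have := hq l (K l) (hK l) (φ l ≫ j l) (by rw [Category.assoc, distTriang_comp₁₂ (hF l), comp_zero])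
  simpa using this =≫ Limits.Sigma.ι Z l

end CompactClosure

/-! ### Classes of coproducts. -/

section Coproducts

variable {C : Type u} [Category.{v} C] {P Q : ObjectProperty C} {α : Cardinal.{v}}

theorem coproductsLT_le_coproducts : coproductsLT α P ≤ coproducts P :=
  fun _ ⟨J, _, h⟩ => ⟨J, h⟩

theorem coproductsLT_monotone (h : P ≤ Q) : coproductsLT α P ≤ coproductsLT α Q :=
  fun _ ⟨J, hJ, hX⟩ => ⟨J, hJ, ObjectProperty.colimitsOfShape_monotone _ h _ hX⟩

instance : (coproductsLT α P).IsClosedUnderIsomorphisms where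
  of_iso e := fun ⟨J, hJ, h⟩ => ⟨J, hJ, ObjectProperty.prop_of_iso _ e h⟩

theorem colimitsOfShape_of_cofan {J : Type v} {K : J → C} {c : Cofan K} (hc : IsColimit c)
    (hK : ∀ j, P (K j)) : P.colimitsOfShape (Discrete J) c.pt :=
  ⟨{ diag := Discrete.functor K
     ι := c.ι
     isColimit := hc
     prop_diag_obj := fun j => hK j.as }⟩

theorem exists_iso_sigma [HasCoproducts.{v} C] {J : Type v} {X : C}
    (h : P.colimitsOfShape (Discrete J) X) : ∃ K : J → C, (∀ j, P (K j)) ∧ Nonempty (X ≅ ∐ K) := by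
  obtain ⟨p⟩ := h
  exact ⟨fun j => p.diag.obj ⟨j⟩, fun j => p.prop_diag_obj ⟨j⟩,
    ⟨p.isColimit.coconePointUniqueUpToIso (colimit.isColimit p.diag) ≪≫
      HasColimit.isoOfNatIso Discrete.natIsoFunctor⟩⟩

theorem le_coproductsLT (hα : 1 < α) : P ≤ coproductsLT α P := by
  intro X hX
  refine ⟨PUnit, by simpa using hα, ?_⟩
  exact colimitsOfShape_of_cofan (c := Cofan.mk X fun _ : PUnit.{v+1} => 𝟙 X)
    (Cofan.IsColimit.mk _ (fun t => t.inj ⟨⟩)) fun _ => hX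

theorem coproductsLT_of_isZero (hα : 0 < α) {X : C} (hX : IsZero X) : coproductsLT α P X := by
  refine ⟨PEmpty, by simpa using hα, ?_⟩
  exact colimitsOfShape_of_cofan (c := Cofan.mk X fun j : PEmpty.{v+1} => PEmpty.elim j)
    (K := PEmpty.elim) (Cofan.IsColimit.mk _ (fun t => hX.to_ _) (fun _ j => j.elim)
      fun t m _ => hX.eq_of_src _ _) fun j => j.elim

/-- A coproduct of which fewer than `α` terms are nonzero is a coproduct of fewer than `α`
terms. -/
theorem coproductsLT_sigma_of_sparse [HasZeroMorphisms C] [HasCoproducts.{v} C] {Λ : Type v}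
    (K : Λ → C) (hK : ∀ l, P (K l)) (h : Cardinal.mk {l // ¬ IsZero (K l)} < α) :
    coproductsLT α P (∐ K) := by
  classical
  refine ⟨{l // ¬ IsZero (K l)}, h, ?_⟩
  exact colimitsOfShape_of_cofan (K := fun l : {l // ¬ IsZero (K l)} => K l.1)
    (c := Cofan.mk (∐ K) fun l => Limits.Sigma.ι K l.1)
    (Cofan.IsColimit.mk _
      (fun t => Limits.Sigma.desc fun l => if hl : IsZero (K l) then 0 else t.inj ⟨l, hl⟩)
      (fun t j => by simp [j.2])
      (fun t m hm => by
        refine Cofan.IsColimit.hom_ext (coproductIsCoproduct K) _ _ fun l => ?_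
        by_cases hl : IsZero (K l)
        · exact hl.eq_of_src _ _
        · simpa [hl] using hm ⟨l, hl⟩)) fun l => hK l.1

/-- Up to bijection, every index set of size less than `α` is a subset of one fixed set of
cardinality `α`, and these subsets form a small set. -/
theorem essentiallySmall_coproductsLT [ObjectProperty.EssentiallySmall.{v} P] :
    ObjectProperty.EssentiallySmall.{v} (coproductsLT α P) := by
  have (s : Set α.out) : ObjectProperty.EssentiallySmall.{v} (P.colimitsOfShape (Discrete s)) := by
    obtain ⟨Q, _, hQ⟩ := ObjectProperty.EssentiallySmall.exists_small_le' P
    refine ⟨Q.strictColimitsOfShape (Discrete s), inferInstance, ?_⟩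
    rw [ObjectProperty.isoClosure_strictColimitsOfShape,
      ← ObjectProperty.colimitsOfShape_isoClosure Q]
    exact ObjectProperty.colimitsOfShape_monotone _ hQ
  have : ObjectProperty.EssentiallySmall.{v}
      (⨆ s : Set α.out, P.colimitsOfShape (Discrete s)) := inferInstance
  refine ObjectProperty.EssentiallySmall.of_le
    (Q := ⨆ s : Set α.out, P.colimitsOfShape (Discrete s)) ?_
  rintro X ⟨J, hJ, hX⟩
  rw [← Cardinal.mk_out α] at hJ
  obtain ⟨f⟩ := hJ.le
  rw [ObjectProperty.colimitsOfShape_congr P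
    (Discrete.equivalence (Equiv.ofInjective f f.injective))] at hX
  simp only [iSup_apply, iSup_Prop_eq]
  exact ⟨Set.range f, hX⟩

theorem map_colimitsOfShape {D : Type*} [Category* D] (F : C ⥤ D) {J : Type v}
    [PreservesColimitsOfShape (Discrete J) F] {R : ObjectProperty D}
    (h : ∀ X, P X → R (F.obj X)) {X : C} (hX : P.colimitsOfShape (Discrete J) X) :
    R.colimitsOfShape (Discrete J) (F.obj X) := by
  obtain ⟨p⟩ := hX
  exact ⟨{ toColimitPresentation := p.toColimitPresentation.map F
           prop_diag_obj := fun j => h _ (p.prop_diag_obj j) }⟩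

end Coproducts

/-! ### The classes `S(i)`: smallness, monotonicity and closure of `S(α)`. -/

section Stages

variable {C : Type u} [Category.{v} C] [Preadditive C] [HasZeroObject C] [HasShift C ℤ]
  [∀ n : ℤ, (shiftFunctor C n).Additive] [Pretriangulated C]

/-- The middle term of a distinguished triangle is determined up to isomorphism by its connecting
morphism, and the connecting morphisms between representatives form a small set. -/
theorem essentiallySmall_extensionProduct (P Q : ObjectProperty C)
    [ObjectProperty.EssentiallySmall.{v} P] [ObjectProperty.EssentiallySmall.{v} Q] :
    ObjectProperty.EssentiallySmall.{v} (P.extensionProduct Q) := by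
  obtain ⟨P', _, hP⟩ := ObjectProperty.EssentiallySmall.exists_small_le' P
  obtain ⟨Q', _, hQ⟩ := ObjectProperty.EssentiallySmall.exists_small_le' Q
  choose Y a b hY using fun (i : Σ (X : Subtype P') (Z : Subtype Q'), (Z.1 ⟶ X.1⟦(1 : ℤ)⟧)) =>
    distinguished_cocone_triangle₂ i.2.2
  refine ⟨.ofObj Y, inferInstance, ?_⟩
  refine (ObjectProperty.monotone_extensionProduct_left _ hP).trans ?_
  refine (ObjectProperty.monotone_extensionProduct_right _ hQ).trans ?_
  rw [ObjectProperty.extensionProduct_isoClosure_left,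
    ObjectProperty.extensionProduct_isoClosure_right]
  rintro W ⟨X, Z, f, g, h, hT, hX, hZ⟩
  let i : Σ (X : Subtype P') (Z : Subtype Q'), (Z.1 ⟶ X.1⟦(1 : ℤ)⟧) := ⟨⟨X, hX⟩, ⟨Z, hZ⟩, h⟩
  obtain ⟨m, h1, h2⟩ := distTriang_map₂ hT (hY i) (𝟙 _) (𝟙 _) (by simp [i])
  have h_comm : h ≫ (𝟙 X)⟦(1 : ℤ)⟧' = 𝟙 Z ≫ h := by simp
  let φ : Triangle.mk f g h ⟶ Triangle.mk (a i) (b i) i.2.2 :=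
    { hom₁ := 𝟙 _, hom₂ := m, hom₃ := 𝟙 _, comm₁ := h1, comm₂ := h2, comm₃ := (h_comm : h ≫ (𝟙 X)⟦(1 : ℤ)⟧' = 𝟙 Z ≫ h) }
  have : IsIso m := isIso₂_of_isIso₁₃ φ hT (hY i) (inferInstanceAs (IsIso (𝟙 X)))
    (inferInstanceAs (IsIso (𝟙 Z)))
  exact ⟨Y i, ⟨i⟩, ⟨asIso m⟩⟩

variable {α : Cardinal.{v}} {S : ObjectProperty C}

theorem shift_suspensions {X : C} (hX : suspensions S X) : suspensions S (X⟦(1 : ℤ)⟧) := by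
  obtain ⟨j, s, hs, ⟨e⟩⟩ := hX
  exact ⟨j + 1, s, hs, ⟨(shiftFunctor C (1 : ℤ)).mapIso e ≪≫
    ((shiftFunctorAdd' C (j : ℤ) 1 (j + 1 : ℕ) (by simp)).app s).symm⟩⟩

theorem shift_extensionProduct {P Q P' Q' : ObjectProperty C} (n : ℤ)
    (hP : ∀ X, P X → P' (X⟦n⟧)) (hQ : ∀ X, Q X → Q' (X⟦n⟧)) {X : C}
    (hX : P.extensionProduct Q X) : P'.extensionProduct Q' (X⟦n⟧) := by
  obtain ⟨Y, Z, f, g, h, hT, hY, hZ⟩ := hX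
  exact ⟨_, _, _, _, _, Triangle.shift_distinguished _ hT n, hP _ hY, hQ _ hZ⟩

theorem essentiallySmall_suspensions [ObjectProperty.EssentiallySmall.{v} S] :
    ObjectProperty.EssentiallySmall.{v} (suspensions S) := by
  refine ObjectProperty.EssentiallySmall.of_le
    (Q := ⨆ j : ℕ, S.map (shiftFunctor C (j : ℤ))) ?_
  rintro X ⟨j, s, hs, ⟨e⟩⟩
  simp only [iSup_apply, iSup_Prop_eq]
  exact ⟨j, s, hs, ⟨e.symm⟩⟩

theorem stage_zero : stage α S 0 = ⊥ := by
  unfold stage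
  rw [Ordinal.limitRecOn_zero]

/-- Induction principle for the classes `S(i)`. -/
theorem stage_induction {p : ObjectProperty C → Prop} (hbot : p ⊥)
    (hone : p (coproductsLT α (suspensions S)))
    (hsucc : ∀ P, p P → p (coproductsLT α (P.extensionProduct P)))
    (hlim : ∀ j : Ordinal.{v}, Order.IsSuccLimit j → (∀ i < j, p (stage α S i)) →
      p (fun X => ∃ i : Ordinal.{v}, i < j ∧ stage α S i X)) (i : Ordinal.{v}) :
    p (stage α S i) := by
  induction i using Ordinal.limitRecOn with
  | zero => rwa [stage_zero]
  | add_one i ih =>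
    by_cases hi : i = 0
    · subst hi
      rwa [zero_add, stage_one]
    · rw [stage_add_one _ _ _ hi]
      exact hsucc _ ih
  | limit i hi ih =>
    convert hlim i hi ih using 1
    ext X
    rw [stage_limit _ _ _ hi]
    constructor
    · rintro ⟨i', -, h⟩
      exact ⟨i', h⟩
    · rintro ⟨i', h, hX⟩
      refine ⟨i', Order.one_le_iff_pos.2 (pos_iff_ne_zero.2 ?_), h, hX⟩
      rintro rfl
      rw [stage_zero] at hX
      exact hX

theorem stage_le {P : ObjectProperty C} (h₁ : coproductsLT α (suspensions S) ≤ P)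
    (h₂ : coproductsLT α (P.extensionProduct P) ≤ P) (i : Ordinal.{v}) : stage α S i ≤ P := by
  refine stage_induction (p := fun Q => Q ≤ P) bot_le h₁ (fun Q hQ => ?_) (fun j _ ih => ?_) i
  · refine (coproductsLT_monotone ?_).trans h₂
    exact (ObjectProperty.monotone_extensionProduct_left _ hQ).trans
      (ObjectProperty.monotone_extensionProduct_right _ hQ)
  · rintro X ⟨i, hi, hX⟩
    exact ih i hi X hX

theorem shift_stage (i : Ordinal.{v}) {X : C} (hX : stage α S i X) :
    stage α S i (X⟦(1 : ℤ)⟧) := by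
  revert X
  refine stage_induction (p := fun P => ∀ {X : C}, P X → P (X⟦(1 : ℤ)⟧)) (fun h => h) ?_ ?_ ?_ i
  · rintro X ⟨J, hJ, h⟩
    exact ⟨J, hJ, map_colimitsOfShape _ (fun X => shift_suspensions) h⟩
  · rintro P hP X ⟨J, hJ, h⟩
    exact ⟨J, hJ, map_colimitsOfShape _
      (fun X => shift_extensionProduct 1 (fun _ => hP) (fun _ => hP)) h⟩
  · rintro j - ih X ⟨i, hi, h⟩
    exact ⟨i, hi, ih i hi h⟩

instance isClosedUnderIsomorphisms_stage (i : Ordinal.{v}) :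
    (stage α S i).IsClosedUnderIsomorphisms := by
  refine stage_induction (p := fun P => P.IsClosedUnderIsomorphisms) ⟨fun _ h => h⟩
    inferInstance (fun P _ => inferInstance) (fun j _ ih => ⟨?_⟩) i
  rintro X Y e ⟨i, hi, h⟩
  exact ⟨i, hi, (ih i hi).of_iso e h⟩

theorem essentiallySmall_stage [ObjectProperty.EssentiallySmall.{v} S] (i : Ordinal.{v}) :
    ObjectProperty.EssentiallySmall.{v} (stage α S i) := by
  have := essentiallySmall_suspensions (S := S)
  refine stage_induction (p := fun P => ObjectProperty.EssentiallySmall.{v} P)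
    ⟨⊥, ⟨PEmpty, ⟨⟨fun X => X.2.elim, fun X => X.elim, fun X => X.2.elim, fun X => X.elim⟩⟩⟩,
      bot_le⟩ essentiallySmall_coproductsLT
    (fun P _ => ?_) (fun j _ ih => ?_) i
  · have := essentiallySmall_extensionProduct P P
    exact essentiallySmall_coproductsLT
  · have : ∀ i : Set.Iio j, ObjectProperty.EssentiallySmall.{v} (stage α S i.1) :=
      fun i => ih i.1 i.2
    refine ObjectProperty.EssentiallySmall.of_le (Q := ⨆ i : Set.Iio j, stage α S i.1) ?_
    rintro X ⟨i, hi, hX⟩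
    simp only [iSup_apply, iSup_Prop_eq]
    exact ⟨⟨i, hi⟩, hX⟩

theorem stage_of_isZero (hα : 0 < α) {i : Ordinal.{v}} (hi : i ≠ 0) {X : C} (hX : IsZero X) :
    stage α S i X := by
  revert hi
  induction i using Ordinal.limitRecOn with
  | zero => exact fun h => (h rfl).elim
  | add_one i ih =>
    intro _
    by_cases hi : i = 0
    · subst hi
      rw [zero_add, stage_one]
      exact coproductsLT_of_isZero hα hX
    · rw [stage_add_one _ _ _ hi]
      exact coproductsLT_of_isZero hα hX
  | limit i hi ih =>
    intro _
    rw [stage_limit _ _ _ hi]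
    exact ⟨1, le_rfl, Ordinal.one_lt_of_isSuccLimit hi,
      ih 1 (Ordinal.one_lt_of_isSuccLimit hi) one_ne_zero⟩

theorem stage_le_extensionProduct (hα : 0 < α) {i : Ordinal.{v}} (hi : i ≠ 0) :
    stage α S i ≤ (stage α S i).extensionProduct (stage α S i) := by
  have : (stage α S i).ContainsZero := ⟨_, isZero_zero C, stage_of_isZero hα hi (isZero_zero C)⟩
  exact ObjectProperty.le_extensionProduct_left (P := stage α S i) (Q := stage α S i)

theorem stage_monotone (hα : 1 < α) : Monotone (stage α S) := by
  intro i j hij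
  by_cases hi : i = 0
  · rw [hi, stage_zero]
    exact bot_le
  induction j using Ordinal.limitRecOn with
  | zero => exact (hi (nonpos_iff_eq_zero.1 hij)).elim
  | add_one j ih =>
    rcases hij.lt_or_eq with h | rfl
    · have hij' := Order.lt_add_one_iff.1 h
      have hj : j ≠ 0 := by
        rintro rfl
        exact hi (nonpos_iff_eq_zero.1 hij')
      refine (ih hij').trans ?_
      rw [stage_add_one _ _ _ hj]
      exact (stage_le_extensionProduct (zero_lt_one.trans hα) hj).trans (le_coproductsLT hα)
    · exact le_rfl
  | limit j hj ih =>
    rcases hij.lt_or_eq with h | rfl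
    · intro X hX
      rw [stage_limit _ _ _ hj]
      exact ⟨i, Order.one_le_iff_pos.2 (pos_iff_ne_zero.2 hi), h, hX⟩
    · exact le_rfl

theorem transfiniteClosure_iff (hα : Cardinal.aleph0 ≤ α) (X : C) :
    transfiniteClosure α S X ↔ ∃ i : Ordinal.{v}, 1 ≤ i ∧ i < α.ord ∧ stage α S i X :=
  stage_limit _ _ _ (Cardinal.isSuccLimit_ord hα) X

theorem suspensions_le_transfiniteClosure (hα : Cardinal.aleph0 ≤ α) :
    suspensions S ≤ transfiniteClosure α S := by
  intro X hX
  rw [transfiniteClosure_iff hα]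
  refine ⟨1, le_rfl, Ordinal.one_lt_of_isSuccLimit (Cardinal.isSuccLimit_ord hα), ?_⟩
  rw [stage_one]
  exact le_coproductsLT (Cardinal.one_lt_aleph0.trans_le hα) _ hX

theorem le_transfiniteClosure (hα : Cardinal.aleph0 ≤ α) : S ≤ transfiniteClosure α S :=
  fun X hX => suspensions_le_transfiniteClosure hα _
    ⟨0, X, hX, ⟨((shiftFunctorZero' C ((0 : ℕ) : ℤ) (by simp)).app X).symm⟩⟩

/-- By regularity, fewer than `α` stages below `α` have a common bound `i` below `α`. Then `S(i)`
lies in `S(i) * S(i)`, so the coproduct already lies in `S(i + 1)`. -/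
theorem coproductsLT_transfiniteClosure_le (hα : α.IsRegular) :
    coproductsLT α (transfiniteClosure α S) ≤ transfiniteClosure α S := by
  rintro X ⟨J, hJ, ⟨p⟩⟩
  have h1 : 1 < α := Cardinal.one_lt_aleph0.trans_le hα.aleph0_le
  choose i hi hi' hX using fun j =>
    (transfiniteClosure_iff hα.aleph0_le _).1 (p.prop_diag_obj ⟨j⟩)
  rw [transfiniteClosure_iff hα.aleph0_le]
  -- The join with `1` handles the empty coproduct, where the supremum is `0` and the successor
  -- formula for stages does not apply.
  have hsup : (⨆ j, i j) ⊔ 1 < α.ord := by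
    refine max_lt ?_ (Ordinal.one_lt_of_isSuccLimit (Cardinal.isSuccLimit_ord hα.aleph0_le))
    exact Ordinal.iSup_lt_of_lt_cof (by rwa [hα.cof_ord]) hi'
  have hne : (⨆ j, i j) ⊔ 1 ≠ 0 := (zero_lt_one.trans_le le_sup_right).ne'
  refine ⟨(⨆ j, i j) ⊔ 1 + 1, Order.one_le_iff_pos.2 (zero_lt_one.trans_le le_add_self),
    (Cardinal.isSuccLimit_ord hα.aleph0_le).add_one_lt hsup, ?_⟩
  rw [stage_add_one _ _ _ hne]
  refine ⟨J, hJ, ⟨{ toColimitPresentation := p.toColimitPresentation, prop_diag_obj := ?_ }⟩⟩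
  rintro ⟨j⟩
  exact stage_le_extensionProduct (zero_lt_one.trans h1) hne _
    (stage_monotone h1 ((Ordinal.le_iSup i j).trans le_sup_left) _ (hX j))

theorem extensionProduct_transfiniteClosure_le (hα : Cardinal.aleph0 ≤ α) :
    (transfiniteClosure α S).extensionProduct (transfiniteClosure α S) ≤
      transfiniteClosure α S := by
  rintro X ⟨Y, Z, f, g, h, hT, hY, hZ⟩
  have h1 : 1 < α := Cardinal.one_lt_aleph0.trans_le hα
  rw [transfiniteClosure_iff hα] at hY hZ ⊢
  obtain ⟨i, hi, hi', hY⟩ := hY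
  obtain ⟨j, hj, hj', hZ⟩ := hZ
  have hne : i ⊔ j ≠ 0 := (zero_lt_one.trans_le (hi.trans le_sup_left)).ne'
  refine ⟨i ⊔ j + 1, Order.one_le_iff_pos.2 (zero_lt_one.trans_le le_add_self),
    (Cardinal.isSuccLimit_ord hα).add_one_lt (max_lt hi' hj'), ?_⟩
  rw [stage_add_one _ _ _ hne]
  exact le_coproductsLT h1 _ ⟨Y, Z, f, g, h, hT, stage_monotone h1 le_sup_left _ hY,
    stage_monotone h1 le_sup_right _ hZ⟩

theorem shift_transfiniteClosure {X : C} (hX : transfiniteClosure α S X) :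
    transfiniteClosure α S (X⟦(1 : ℤ)⟧) := shift_stage _ hX

instance : (transfiniteClosure α S).IsClosedUnderIsomorphisms :=
  isClosedUnderIsomorphisms_stage _

theorem transfiniteClosure_of_isZero (hα : Cardinal.aleph0 ≤ α) {X : C} (hX : IsZero X) :
    transfiniteClosure α S X :=
  stage_of_isZero (Cardinal.aleph0_pos.trans_le hα)
    (by rw [Ne, Cardinal.ord_eq_zero]; exact (Cardinal.aleph0_pos.trans_le hα).ne') hX

theorem isCocompletePreaisle_preaisle : IsCocompletePreaisle (preaisle S) where
  suspension X hX P hP hS := hP.suspension _ (hX P hP hS)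
  extension := by
    rintro X ⟨Y, Z, f, g, h, hT, hY, hZ⟩ P hP hS
    exact hP.extension _ ⟨Y, Z, f, g, h, hT, hY P hP hS, hZ P hP hS⟩
  summand := ⟨fun r hY P hP hS => hP.summand.of_retract r (hY P hP hS)⟩
  coproduct := by
    rintro X ⟨J, hX⟩ P hP hS
    exact hP.coproduct _ ⟨J, ObjectProperty.colimitsOfShape_monotone _
      (fun Y hY => hY P hP hS) _ hX⟩

theorem IsCocompletePreaisle.isClosedUnderIsomorphisms {P : ObjectProperty C}
    (hP : IsCocompletePreaisle P) : P.IsClosedUnderIsomorphisms :=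
  ⟨fun e hX => hP.summand.of_retract e.symm.retract hX⟩

theorem IsCocompletePreaisle.suspensions_le {P : ObjectProperty C}
    (hP : IsCocompletePreaisle P) (hS : S ≤ P) : suspensions S ≤ P := by
  rintro X ⟨j, s, hs, ⟨e⟩⟩
  have := hP.isClosedUnderIsomorphisms
  refine P.prop_of_iso e.symm ?_
  clear e
  induction j with
  | zero => exact P.prop_of_iso ((shiftFunctorZero' C ((0 : ℕ) : ℤ) (by simp)).app s).symm (hS _ hs)
  | succ j ih =>
    exact P.prop_of_iso ((shiftFunctorAdd' C (j : ℤ) 1 (j + 1 : ℕ) (by simp)).app s).symm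
      (hP.suspension _ ih)

theorem IsCocompletePreaisle.transfiniteClosure_le {P : ObjectProperty C}
    (hP : IsCocompletePreaisle P) (hS : S ≤ P) : transfiniteClosure α S ≤ P := by
  refine stage_le ?_ ?_ _
  · exact (coproductsLT_monotone (hP.suspensions_le hS)).trans
      (coproductsLT_le_coproducts.trans hP.coproduct)
  · exact (coproductsLT_monotone hP.extension).trans
      (coproductsLT_le_coproducts.trans hP.coproduct)

theorem transfiniteClosure_le_preaisle : transfiniteClosure α S ≤ preaisle S :=
  isCocompletePreaisle_preaisle.transfiniteClosure_le fun _ hX _ _ hS => hS _ hX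

theorem transfiniteClosure_le_compactClosure [HasCoproducts.{v} C] (hα : α.IsRegular)
    (hS : S ≤ alphaCompact α) : transfiniteClosure α S ≤ compactClosure C α := by
  have := compactClosure_isTriangulated (C := C) hα
  have h : coproductsLT α (compactClosure C α) ≤ compactClosure C α := by
    rintro X ⟨J, hJ, hX⟩
    obtain ⟨K, hK, ⟨e⟩⟩ := exists_iso_sigma hX
    exact (compactClosure.sigma J K hJ hK).iso e.symm
  refine stage_le ((coproductsLT_monotone ?_).trans h) ((coproductsLT_monotone ?_).trans h) _
  · rintro X ⟨j, s, hs, ⟨e⟩⟩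
    exact .iso e.symm (.shift _ _ (.of _ (hS _ hs)))
  · rintro X ⟨Y, Z, f, g, h, hT, hY, hZ⟩
    exact ObjectProperty.ext_of_isTriangulatedClosed₂ _ _ hT hY hZ

end Stages

/-! ### Factoring through `S(α)`, covers and the approximating sequence. -/

section Factorizations

variable {C : Type u} [Category.{v} C] [Preadditive C] [HasZeroObject C] [HasShift C ℤ]
  [∀ n : ℤ, (shiftFunctor C n).Additive] [Pretriangulated C]

/-- Every morphism to `x` from an object of `D` factors through an object of `T`. -/
def factorsThrough (D T : ObjectProperty C) : ObjectProperty C :=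
  fun x => ∀ k, D k → ∀ u : k ⟶ x, ∃ (s : C) (a : k ⟶ s) (b : s ⟶ x), T s ∧ a ≫ b = u

theorem exists_eq_shift {D : ObjectProperty C} [D.IsStableUnderShift ℤ] {k x : C} (hk : D k)
    (u : k ⟶ x⟦(1 : ℤ)⟧) :
    ∃ (k' : C) (e : k ≅ k'⟦(1 : ℤ)⟧) (u' : k' ⟶ x), D k' ∧ u = e.hom ≫ u'⟦(1 : ℤ)⟧' := by
  let e : k ≅ (k⟦(-1 : ℤ)⟧)⟦(1 : ℤ)⟧ := ((shiftEquiv C (1 : ℤ)).counitIso.app k).symm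
  exact ⟨k⟦(-1 : ℤ)⟧, e, (shiftFunctor C (1 : ℤ)).preimage (e.inv ≫ u),
    D.le_shift (-1) _ hk, by simp⟩

variable {D T : ObjectProperty C}

theorem factorsThrough_shift [D.IsStableUnderShift ℤ] (hT : ∀ X, T X → T (X⟦(1 : ℤ)⟧)) {x : C}
    (hx : factorsThrough D T x) : factorsThrough D T (x⟦(1 : ℤ)⟧) := by
  intro k hk u
  obtain ⟨k', e, u', hk', rfl⟩ := exists_eq_shift hk u
  obtain ⟨s, a, b, hs, rfl⟩ := hx k' hk' u'
  exact ⟨s⟦(1 : ℤ)⟧, e.hom ≫ a⟦(1 : ℤ)⟧', b⟦(1 : ℤ)⟧', hT _ hs, by simp⟩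

/-- Factor `k ⟶ z` through `z'` in `T`. The obstruction to lifting `z' ⟶ z` to `y` is a map to
`x⟦1⟧` that extends over the cone of `k ⟶ z'`, an object of `D`; hence it factors through some
`x'⟦1⟧` with `x'` in `T`. This builds an extension `y'` of `z'` by `x'` mapping to `y`. What remains
of `u` comes from `x` and factors through a further `x''` in `T`. -/
theorem factorsThrough_extensionProduct [D.IsTriangulated] [D.IsClosedUnderIsomorphisms]
    (hTD : T ≤ D) (hT : T.extensionProduct T ≤ T) :
    (factorsThrough D T).extensionProduct (factorsThrough D T) ≤ factorsThrough D T := by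
  rintro y ⟨x, z, i, p, δ, hy, hx, hz⟩ k hk u
  obtain ⟨z', a, b, hz', hab⟩ := hz k hk (u ≫ p)
  obtain ⟨m, hm, r, s, hrs⟩ := D.distinguished_cocone_triangle a hk (hTD _ hz')
  obtain ⟨t, ht⟩ := distTriang_desc₃ hrs (b ≫ δ) (by
    rw [← Category.assoc, hab, Category.assoc, distTriang_comp₂₃ hy, comp_zero])
  obtain ⟨m', e, t', hm', rfl⟩ := exists_eq_shift hm t
  obtain ⟨x', c, d, hx', rfl⟩ := hx m' hm' t'
  obtain ⟨y', i', p', hy'⟩ := distinguished_cocone_triangle₂ (r ≫ e.hom ≫ c⟦(1 : ℤ)⟧')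
  obtain ⟨w, hw1, hw2⟩ := distTriang_map₂ hy' hy d b (by simpa using ht)
  obtain ⟨v, hv⟩ := distTriang_lift₂ hy' a (by
    rw [← Category.assoc, distTriang_comp₁₂ hrs, zero_comp])
  obtain ⟨v', hv'⟩ := distTriang_lift₁ hy (u - v ≫ w) (by
    rw [Preadditive.sub_comp, Category.assoc, ← hw2, reassoc_of% hv, hab, sub_self])
  obtain ⟨x'', c', d', hx'', rfl⟩ := hx k hk v'
  refine ⟨y' ⊞ x'', biprod.lift v c', biprod.desc w (d' ≫ i),
    hT _ ⟨_, _, _, _, _, binaryBiproductTriangle_distinguished y' x'',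
      hT _ ⟨_, _, _, _, _, hy', hx', hz'⟩, hx''⟩, ?_⟩
  rw [biprod.lift_desc, ← Category.assoc, hv']
  abel

theorem factorsThrough_coproducts [HasCoproducts.{v} C] {α : Cardinal.{v}}
    (hD : ∀ k, D k → HasSparseFactorizations D α k) (hT : coproductsLT α T ≤ T)
    (hT' : ∀ X, IsZero X → T X) : coproducts (factorsThrough D T) ≤ factorsThrough D T := by
  rintro x ⟨J, hx⟩ k hk u
  obtain ⟨X, hX, ⟨e⟩⟩ := exists_iso_sigma hx
  obtain ⟨K, φ, g, hK, hK', hg⟩ := hD k hk J X (u ≫ e.hom)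
  have h (j : J) : ∃ (s : C) (a : K j ⟶ s) (b : s ⟶ X j), T s ∧ a ≫ b = φ j ∧
      (IsZero (K j) → IsZero s) := by
    by_cases hj : IsZero (K j)
    -- Choosing a zero object wherever `K j` is zero keeps the number of nonzero `s j` below `α`, so
    -- that `∐ s` remains in `T`.
    · exact ⟨K j, 𝟙 _, φ j, hT' _ hj, by simp, id⟩
    · obtain ⟨s, a, b, hs, hab⟩ := hX j _ (hK j) (φ j)
      exact ⟨s, a, b, hs, hab, fun h => (hj h).elim⟩
  choose s a b hs hab hz using h
  refine ⟨∐ s, g ≫ Limits.Sigma.map a, Limits.Sigma.map b ≫ e.inv,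
    hT _ (coproductsLT_sigma_of_sparse s hs ?_), ?_⟩
  · exact lt_of_le_of_lt (Cardinal.mk_le_mk_of_subset (s := {l | ¬ IsZero (s l)})
      (t := {l | ¬ IsZero (K l)}) fun l hl hl' => hl (hz l hl')) hK'
  · have : Limits.Sigma.map a ≫ Limits.Sigma.map b = Limits.Sigma.map φ := by
      ext j
      simp [reassoc_of% (hab j)]
    rw [Category.assoc, reassoc_of% this, reassoc_of% hg, e.hom_inv_id, Category.comp_id]

/-- Minimality of `preaisle S` turns this into a factorization statement for all its objects, once
it is known for `S`. -/
theorem isCocompletePreaisle_factorsThrough [HasCoproducts.{v} C] [D.IsTriangulated]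
    [D.IsClosedUnderIsomorphisms] {α : Cardinal.{v}}
    (hD : ∀ k, D k → HasSparseFactorizations D α k) (hTD : T ≤ D)
    (hT : ∀ X, T X → T (X⟦(1 : ℤ)⟧)) (hText : T.extensionProduct T ≤ T)
    (hTcoprod : coproductsLT α T ≤ T) (hTzero : ∀ X, IsZero X → T X) :
    IsCocompletePreaisle (factorsThrough D T) where
  suspension _ := factorsThrough_shift hT
  extension := factorsThrough_extensionProduct hTD hText
  summand := ⟨fun r hY k hk u => by
    obtain ⟨s, a, b, hs, hab⟩ := hY k hk (u ≫ r.i)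
    exact ⟨s, a, b ≫ r.r, hs, by rw [reassoc_of% hab, r.retract, Category.comp_id]⟩⟩
  coproduct := factorsThrough_coproducts hD hTcoprod hTzero

/-- The cover is the coproduct over all maps to `x` from a small set of representatives of `T`. -/
theorem exists_cover [HasCoproducts.{v} C] [ObjectProperty.EssentiallySmall.{v} T] {x : C}
    (hx : factorsThrough D T x) :
    ∃ (c : C) (p : c ⟶ x), coproducts T c ∧
      ∀ k, D k → ∀ u : k ⟶ x, ∃ u' : k ⟶ c, u' ≫ p = u := by
  obtain ⟨Q, _, hQ, hQ'⟩ := ObjectProperty.EssentiallySmall.exists_small_le T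
  let I := Σ s : Subtype Q, (s.1 ⟶ x)
  let K : Shrink.{v} I → C := fun i => ((equivShrink I).symm i).1.1
  refine ⟨∐ K, Limits.Sigma.desc fun i => ((equivShrink I).symm i).2,
    ⟨_, colimitsOfShape_of_cofan (coproductIsCoproduct K) fun i => hQ _ (Subtype.prop _)⟩, ?_⟩
  intro k hk u
  obtain ⟨s, a, b, hs, rfl⟩ := hx k hk u
  obtain ⟨s', hs', ⟨e⟩⟩ := hQ' _ hs
  obtain ⟨i, hi⟩ : ∃ i, (equivShrink I).symm i = ⟨⟨s', hs'⟩, e.inv ≫ b⟩ :=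
    (equivShrink I).symm.surjective _
  have key : ∃ m : s' ⟶ K i, m ≫ ((equivShrink I).symm i).2 = e.inv ≫ b := by
    change ∃ m : s' ⟶ ((equivShrink I).symm i).1.1, m ≫ ((equivShrink I).symm i).2 = e.inv ≫ b
    rw [hi]
    exact ⟨𝟙 _, Category.id_comp _⟩
  obtain ⟨m, hm⟩ := key
  exact ⟨a ≫ e.hom ≫ m ≫ Limits.Sigma.ι K i, by simp [hm]⟩

/-- Given `p : y ⟶ x`, one attaches to `y` a coproduct of objects of `T` so as to annihilate the
morphisms from objects of `D` which are annihilated by `p`. -/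
theorem exists_extension [HasCoproducts.{v} C] [D.IsStableUnderShift ℤ]
    [ObjectProperty.EssentiallySmall.{v} T] {P : ObjectProperty C} (hP : IsCocompletePreaisle P)
    (hTP : T ≤ P) (hPDT : P ≤ factorsThrough D T) {x y : C} (hx : P x) (hy : P y) (p : y ⟶ x) :
    ∃ (y' c : C) (f : y ⟶ y') (m : y' ⟶ c) (δ : c ⟶ y⟦(1 : ℤ)⟧) (p' : y' ⟶ x),
      Triangle.mk f m δ ∈ distTriang C ∧ P y' ∧ coproducts T c ∧ f ≫ p' = p ∧
        ∀ k, D k → ∀ u : k ⟶ y, u ≫ p = 0 → u ≫ f = 0 := by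
  obtain ⟨W, g, h, hW⟩ := distinguished_cocone_triangle p
  have hW' : Triangle.mk g h (-p⟦(1 : ℤ)⟧') ∈ distTriang C := rot_of_distTriang _ hW
  -- The cone of `p` is an extension of `y⟦1⟧` by `x`, so it stays in the pre-aisle and has a cover
  -- `c`. Attaching `c` to `y` along `c ⟶ W ⟶ y⟦1⟧` defines `y'`.
  have hPW : P W := hP.extension _ ⟨_, _, _, _, _, hW', hx, hP.suspension _ hy⟩
  obtain ⟨c, r, hc, hr⟩ := exists_cover (hPDT _ hPW)
  obtain ⟨y', f, m, hy'⟩ := distinguished_cocone_triangle₂ (r ≫ h)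
  obtain ⟨p', hp', -⟩ := distTriang_map₂ hy' hW (𝟙 _) r (by simp)
  have hPc : P c := by
    obtain ⟨J, hJ⟩ := hc
    exact hP.coproduct _ ⟨J, ObjectProperty.colimitsOfShape_monotone _ hTP _ hJ⟩
  refine ⟨y', c, f, m, _, p', hy', hP.extension _ ⟨_, _, _, _, _, hy', hy, hPc⟩, hc,
    by simpa using hp', fun k hk u hu => ?_⟩
  -- Since `u ≫ p = 0`, the shift of `u` lifts to `W` and then to `c`; so it factors through the
  -- connecting map of the new triangle, which `f⟦1⟧` annihilates.
  obtain ⟨t, ht⟩ := distTriang_lift₂ hW' (u⟦(1 : ℤ)⟧') (by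
    rw [Preadditive.comp_neg, ← Functor.map_comp, hu, Functor.map_zero, neg_zero])
  obtain ⟨t', rfl⟩ := hr _ (D.le_shift 1 _ hk) t
  apply (shiftFunctor C (1 : ℤ)).map_injective
  rw [Functor.map_comp, ← ht, Functor.map_zero]
  have := distTriang_comp₃₁ hy'
  rw [Category.assoc] at this
  rw [Category.assoc, Category.assoc, this, comp_zero]

/-- An object of a cocomplete preaisle all of whose objects admit factorizations through `T` is
approximated by a sequence of iterated extensions of coproducts of objects of `T`. -/
theorem exists_approximating_sequence [HasCoproducts.{v} C] [D.IsStableUnderShift ℤ]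
    [ObjectProperty.EssentiallySmall.{v} T] {P : ObjectProperty C} (hP : IsCocompletePreaisle P)
    (hTP : T ≤ P) (hPDT : P ≤ factorsThrough D T) {x : C} (hx : P x) :
    ∃ (X : ℕ → C) (f : ∀ n, X n ⟶ X (n + 1)) (p : ∀ n, X n ⟶ x),
      (∀ n, coprodExt T (n + 1) (X n)) ∧ (∀ n, f n ≫ p (n + 1) = p n) ∧
      (∀ k, D k → ∀ u : k ⟶ x, ∃ u' : k ⟶ X 0, u' ≫ p 0 = u) ∧
      ∀ n k, D k → ∀ u : k ⟶ X n, u ≫ p n = 0 → u ≫ f n = 0 := by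
  obtain ⟨c, p, hc, hp⟩ := exists_cover (hPDT _ hx)
  have hPc : P c := by
    obtain ⟨J, hJ⟩ := hc
    exact hP.coproduct _ ⟨J, ObjectProperty.colimitsOfShape_monotone _ hTP _ hJ⟩
  -- Membership in `P` is carried along the recursion because each extension step requires it.
  let A := Σ y : {y : C // P y}, (y.1 ⟶ x)
  choose y' c' f m δ p' hT hPy' hc' hp' hf using
    fun a : A => exists_extension hP hTP hPDT hx a.1.2 a.2
  let a : ℕ → A := fun n => Nat.rec ⟨⟨c, hPc⟩, p⟩ (fun _ b => ⟨⟨y' b, hPy' b⟩, p' b⟩) n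
  refine ⟨fun n => (a n).1.1, fun n => f (a n), fun n => (a n).2, fun n => ?_,
    fun n => hp' (a n), hp, fun n => hf (a n)⟩
  induction n with
  | zero => exact hc
  | succ n ih => exact ⟨_, _, _, _, _, hT (a n), ih, hc' (a n)⟩

end Factorizations

/-! ### Recognizing the homotopy colimit. -/

section HomotopyColimit

variable {C : Type u} [Category.{v} C] [Preadditive C] [HasZeroObject C] [HasShift C ℤ]
  [∀ n : ℤ, (shiftFunctor C n).Additive] [Pretriangulated C] [HasCoproducts.{v} C]

/-- The coproduct of a sequence of objects. -/
noncomputable abbrev seqCoproduct (X : ℕ → C) : C := ∐ fun n : ULift.{v} ℕ => X n.down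

/-- The shift endomorphism of the coproduct of a sequence. -/
noncomputable def seqShift (X : ℕ → C) (f : ∀ n, X n ⟶ X (n + 1)) :
    seqCoproduct X ⟶ seqCoproduct X :=
  Limits.Sigma.desc fun n =>
    f n.down ≫ Limits.Sigma.ι (fun n : ULift.{v} ℕ => X n.down) ⟨n.down + 1⟩

theorem ι_seqShift (X : ℕ → C) (f : ∀ n, X n ⟶ X (n + 1)) (n : ULift.{v} ℕ) :
    Limits.Sigma.ι (fun n : ULift.{v} ℕ => X n.down) n ≫ seqShift X f =
      f n.down ≫ Limits.Sigma.ι (fun n : ULift.{v} ℕ => X n.down) ⟨n.down + 1⟩ := by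
  simp [seqShift]

/-- For a constant sequence, `1 - shift` is a split monomorphism. -/
theorem exists_one_sub_seqShift_retraction (x : C) :
    ∃ r : seqCoproduct (fun _ => x) ⟶ seqCoproduct (fun _ => x),
      (𝟙 _ - seqShift (fun _ => x) (fun _ => 𝟙 x)) ≫ r = 𝟙 _ ∧
      ∀ (k : C) (w : k ⟶ seqCoproduct (fun _ => x)), w ≫ Limits.Sigma.desc (fun _ => 𝟙 x) = 0 →
        w ≫ r ≫ (𝟙 _ - seqShift (fun _ => x) (fun _ => 𝟙 x)) = w := by
  let i : ℕ → (x ⟶ seqCoproduct (fun _ => x)) :=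
    fun n => Limits.Sigma.ι (fun _ : ULift.{v} ℕ => x) ⟨n⟩
  -- Sums telescope: `r` inverts `1 - shift` on one side, and on the other side the composite is the
  -- identity minus the codiagonal followed by the inclusion of the summand `0`.
  let r : seqCoproduct (fun _ => x) ⟶ seqCoproduct (fun _ => x) :=
    Limits.Sigma.desc fun n => -∑ j ∈ Finset.range n.down, i j
  have hs (n : ℕ) : i n ≫ seqShift (fun _ => x) (fun _ => 𝟙 x) = i (n + 1) := by
    simpa using ι_seqShift (fun _ => x) (fun _ => 𝟙 x) ⟨n⟩
  have hr (n : ℕ) : i n ≫ r = -∑ j ∈ Finset.range n, i j := by simp [i, r]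
  refine ⟨r, ?_, fun k w hw => ?_⟩
  · refine Limits.Sigma.hom_ext _ _ fun n => ?_
    change i n.down ≫ _ = i n.down ≫ _
    rw [Preadditive.sub_comp, Preadditive.comp_sub, Category.id_comp, ← Category.assoc, hs, hr, hr,
      Finset.sum_range_succ, Category.comp_id]
    abel
  · have h : r ≫ (𝟙 _ - seqShift (fun _ => x) (fun _ => 𝟙 x)) =
        𝟙 _ - Limits.Sigma.desc (fun _ => 𝟙 x) ≫ i 0 := by
      refine Limits.Sigma.hom_ext _ _ fun n => ?_
      have hd : i n.down ≫ Limits.Sigma.desc (fun _ => 𝟙 x) = 𝟙 x := by simp [i]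
      change i n.down ≫ _ = i n.down ≫ _
      rw [← Category.assoc, hr, Preadditive.comp_sub, Preadditive.comp_sub, ← Category.assoc, hd,
        Preadditive.neg_comp, Preadditive.sum_comp]
      simp only [Preadditive.neg_comp, Preadditive.sum_comp, Category.comp_id, Category.id_comp, hs]
      rw [neg_sub_neg, ← Finset.sum_sub_distrib, Finset.sum_range_sub]
    rw [h, Preadditive.comp_sub, ← Category.assoc, hw, zero_comp, sub_zero, Category.comp_id]

variable {D : ObjectProperty C} {α : Cardinal.{v}}

/-- Let `p n : X n ⟶ x` be compatible morphisms which are surjective on morphisms from objects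
of `D`, and such that `X n ⟶ X (n + 1)` annihilates all morphisms from objects of `D` annihilated
by `p n`. If `D` is triangulated, generates, and has sparse factorizations, then `x` is the
homotopy colimit of the sequence. -/
theorem isHomotopyColimit_of_approximating_sequence [D.IsStableUnderShift ℤ]
    (hD : ∀ k, D k → HasSparseFactorizations D α k)
    (hgen : ∀ d : C, (∀ k, D k → ∀ u : k ⟶ d, u = 0) → IsZero d)
    {x : C} (X : ℕ → C) (f : ∀ n, X n ⟶ X (n + 1)) (p : ∀ n, X n ⟶ x)
    (hfp : ∀ n, f n ≫ p (n + 1) = p n)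
    (hp : ∀ k, D k → ∀ u : k ⟶ x, ∃ u' : k ⟶ X 0, u' ≫ p 0 = u)
    (hf : ∀ n k, D k → ∀ u : k ⟶ X n, u ≫ p n = 0 → u ≫ f n = 0) :
    IsHomotopyColimit X f x := by
  obtain ⟨r, hr, hr'⟩ := exists_one_sub_seqShift_retraction x
  let σ := seqShift X f
  let τ : seqCoproduct (fun _ => x) ⟶ _ := seqShift (fun _ => x) (fun _ => 𝟙 x)
  let Φ : seqCoproduct X ⟶ seqCoproduct (fun _ => x) := Limits.Sigma.map fun n => p n.down
  let π : seqCoproduct X ⟶ x := Φ ≫ Limits.Sigma.desc fun _ => 𝟙 x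
  have hΦ : σ ≫ Φ = Φ ≫ τ := by
    refine Limits.Sigma.hom_ext _ _ fun n => ?_
    rw [← Category.assoc, ι_seqShift]
    have h : Limits.Sigma.ι (fun _ : ULift.{v} ℕ => x) n ≫ τ =
        Limits.Sigma.ι (fun _ : ULift.{v} ℕ => x) ⟨n.down + 1⟩ :=
      (ι_seqShift (fun _ => x) (fun _ => 𝟙 x) n).trans (Category.id_comp _)
    simp [Φ, h, reassoc_of% hfp]
  have hΦ' : (𝟙 _ - σ) ≫ Φ = Φ ≫ (𝟙 _ - τ) := by
    rw [Preadditive.sub_comp, Preadditive.comp_sub, hΦ, Category.id_comp, Category.comp_id]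
  have hπ : (𝟙 _ - σ) ≫ π = 0 := by
    refine Limits.Sigma.hom_ext _ _ fun n => ?_
    rw [Preadditive.sub_comp, Preadditive.comp_sub, ← Category.assoc _ σ, ι_seqShift]
    simp [π, Φ, hfp]
  have hp' : ∀ n k, D k → ∀ u : k ⟶ x, ∃ u' : k ⟶ X n, u' ≫ p n = u := by
    intro n
    induction n with
    | zero => exact hp
    | succ n ih =>
      intro k hk u
      obtain ⟨u', hu'⟩ := ih k hk u
      exact ⟨u' ≫ f n, by rw [Category.assoc, hfp, hu']⟩
  have hσ (k : C) (hk : D k) (w : k ⟶ seqCoproduct X) (hw : w ≫ Φ = 0) : w ≫ σ = 0 := by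
    have h := comp_sigmaMap_eq_zero (hD k hk) (fun n : ULift.{v} ℕ => p n.down)
      (fun n => f n.down) (fun n => hf n.down) w hw
    have e : σ = Limits.Sigma.map (fun n : ULift.{v} ℕ => f n.down) ≫
        Limits.Sigma.desc fun n => Limits.Sigma.ι (fun n : ULift.{v} ℕ => X n.down)
          ⟨n.down + 1⟩ := by
      refine Limits.Sigma.hom_ext _ _ fun n => ?_
      rw [ι_seqShift]
      simp
    rw [e, reassoc_of% h, zero_comp]
  -- A `w` killed by `1 - σ` maps to something killed by the split monomorphism `1 - τ`, so `w ≫ Φ =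
  -- 0`. Then `σ` kills `w`, and `w = w ≫ σ = 0`.
  have hinj (k : C) (hk : D k) (w : k ⟶ seqCoproduct X) (hw : w ≫ (𝟙 _ - σ) = 0) : w = 0 := by
    have h : w ≫ Φ = 0 := by
      rw [← Category.comp_id (w ≫ Φ), ← hr, Category.assoc, ← reassoc_of% hΦ', reassoc_of% hw,
        zero_comp]
    rw [Preadditive.comp_sub, Category.comp_id, hσ k hk w h, sub_zero] at hw
    exact hw
  have hex (k : C) (hk : D k) (w : k ⟶ seqCoproduct X) (hw : w ≫ π = 0) :
      ∃ w', w' ≫ (𝟙 _ - σ) = w := by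
    -- Solve the equation in the constant sequence with `r`, and lift the solution along `Φ`. The
    -- error is killed by `Φ`, hence by `σ`, so `1 - σ` fixes it and it may be added to `w'`.
    obtain ⟨w', hw'⟩ := exists_lift_sigma_of_surjective (hD k hk)
      (fun n : ULift.{v} ℕ => p n.down) (fun n => hp' n.down) (w ≫ Φ ≫ r)
    have h : (w - w' ≫ (𝟙 _ - σ)) ≫ Φ = 0 := by
      have h1 := hr' k (w ≫ Φ) (by rw [Category.assoc]; exact hw)
      have h2 : w' ≫ Φ = w ≫ Φ ≫ r := hw'
      rw [Preadditive.sub_comp, Category.assoc, hΦ', ← Category.assoc w', h2, sub_eq_zero]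
      simpa using h1.symm
    refine ⟨w' + (w - w' ≫ (𝟙 _ - σ)), ?_⟩
    rw [Preadditive.add_comp, Preadditive.comp_sub (w - _), hσ k hk _ h, Category.comp_id]
    abel
  obtain ⟨H, π', δ, hH⟩ := distinguished_cocone_triangle (𝟙 _ - σ)
  obtain ⟨q, hq⟩ := distTriang_desc₃ hH π hπ
  -- Injectivity of `1 - σ` on maps from `D` makes `w` come from `∐ X`; exactness at `∐ X` then puts
  -- this lift in the image of `1 - σ`, so it dies in `H`.
  have hqinj (k : C) (hk : D k) (w : k ⟶ H) (hw : w ≫ q = 0) : w = 0 := by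
    obtain ⟨k', e, t, hk', ht⟩ := exists_eq_shift hk (w ≫ δ)
    have ht0 : t = 0 := by
      refine hinj k' hk' t ((shiftFunctor C (1 : ℤ)).map_injective ?_)
      rw [← cancel_epi e.hom, Functor.map_comp, ← reassoc_of% ht, distTriang_comp₃₁ hH]
      simp
    obtain ⟨s, rfl⟩ := distTriang_lift₂ hH w (by rw [ht, ht0, Functor.map_zero, comp_zero])
    obtain ⟨s', rfl⟩ := hex k hk s (by rw [← hq, ← Category.assoc, hw])
    rw [Category.assoc, distTriang_comp₁₂ hH, comp_zero]
  obtain ⟨d, g, ε, hd⟩ := distinguished_cocone_triangle q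
  -- Seen from `D`, `q` is injective by `hqinj` and surjective because maps to `x` already lift to
  -- `X 0`; so its cone receives no nonzero map from `D`.
  have hd0 : IsZero d := by
    refine hgen d fun k hk u => ?_
    obtain ⟨k', e, t, hk', ht⟩ := exists_eq_shift hk (u ≫ ε)
    have ht0 : t = 0 := by
      refine hqinj k' hk' t ((shiftFunctor C (1 : ℤ)).map_injective ?_)
      rw [← cancel_epi e.hom, Functor.map_comp, ← reassoc_of% ht, distTriang_comp₃₁ hd]
      simp
    obtain ⟨s, rfl⟩ := distTriang_lift₂ hd u (by rw [ht, ht0, Functor.map_zero, comp_zero])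
    obtain ⟨s', rfl⟩ := hp k hk s
    have h : p 0 = Limits.Sigma.ι (fun n : ULift.{v} ℕ => X n.down) ⟨0⟩ ≫ π' ≫ q := by
      rw [hq]
      simp [π, Φ]
    rw [h]
    simp [distTriang_comp₁₂ hd]
  have hqiso : IsIso q := (Triangle.isZero₃_iff_isIso₁ _ hd).1 hd0
  -- The coproduct indexed by `ULift ℕ` is reindexed by `ℕ`, as `IsHomotopyColimit` requires.
  let c : Cofan X := Cofan.mk (seqCoproduct X) fun n =>
    Limits.Sigma.ι (fun n : ULift.{v} ℕ => X n.down) ⟨n⟩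
  let hc : IsColimit c := Cofan.IsColimit.mk _
    (fun t => Limits.Sigma.desc (f := fun n : ULift.{v} ℕ => X n.down) fun n => t.inj n.down)
    (fun t j => by simp [c])
    (fun t m hm => Limits.Sigma.hom_ext (f := fun n : ULift.{v} ℕ => X n.down) _ _ fun n =>
      (hm n.down).trans (by simp))
  refine ⟨c, hc, π' ≫ q, inv q ≫ δ, ?_⟩
  have e : Cofan.IsColimit.desc hc (fun n => c.inj n - f n ≫ c.inj (n + 1)) = 𝟙 _ - σ := by
    refine Cofan.IsColimit.hom_ext hc _ _ fun n => ?_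
    refine (Cofan.IsColimit.fac hc _ n).trans ?_
    change c.inj n - f n ≫ c.inj (n + 1) =
      Limits.Sigma.ι (fun n : ULift.{v} ℕ => X n.down) ⟨n⟩ ≫ (𝟙 _ - σ)
    rw [Preadditive.comp_sub, Category.comp_id]
    congr 1
    exact (ι_seqShift X f ⟨n⟩).symm
  rw [e]
  have hcomm : (inv q ≫ δ) ≫ (𝟙 (seqCoproduct X))⟦(1 : ℤ)⟧' = inv q ≫ δ := by simp
  exact isomorphic_distinguished _ hH _ (Triangle.isoMk _ _ (Iso.refl _) (Iso.refl _)
    (asIso q).symm ((Category.comp_id _).trans (Category.id_comp _).symm)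
    (by
      change (π' ≫ q) ≫ inv q = 𝟙 _ ≫ π'
      simp)
    hcomm)

end HomotopyColimit

end WellGenerated

/-! ### The main theorem. -/

theorem proposition2p9 {C : Type u} [Category.{v} C] [Preadditive C] [HasZeroObject C]
    [HasShift C ℤ] [∀ n : ℤ, (shiftFunctor C n).Additive] [Pretriangulated C] [IsTriangulated C]
    [HasCoproducts.{v} C] (S : ObjectProperty C) (hS : ObjectProperty.Small.{v} S)
    (α : Cardinal.{v}) (hα : α.IsRegular)
    (hC : WellGenerated.IsAlphaCompactlyGenerated C α)
    (hSα : S ≤ WellGenerated.alphaCompact α)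
    (x : C) (hx : WellGenerated.preaisle S x) :
    ∃ (X : ℕ → C) (f : ∀ n, X n ⟶ X (n + 1)),
      (∀ n, WellGenerated.coprodExt (WellGenerated.transfiniteClosure α S) (n + 1) (X n)) ∧
      WellGenerated.IsHomotopyColimit X f x := by
  open WellGenerated in
  have := compactClosure_isTriangulated (C := C) hα
  have : ObjectProperty.EssentiallySmall.{v} (transfiniteClosure α S) := essentiallySmall_stage _
  have hD (k : C) (hk : compactClosure C α k) :
      HasSparseFactorizations (compactClosure C α) α k := hk.hasSparseFactorizations hα
  have hfac : IsCocompletePreaisle (factorsThrough (compactClosure C α) (transfiniteClosure α S)) :=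
    isCocompletePreaisle_factorsThrough hD (transfiniteClosure_le_compactClosure hα hSα)
      (fun _ => shift_transfiniteClosure) (extensionProduct_transfiniteClosure_le hα.aleph0_le)
      (coproductsLT_transfiniteClosure_le hα)
      (fun _ => transfiniteClosure_of_isZero hα.aleph0_le)
  obtain ⟨X, f, p, hX, hfp, hp, hf⟩ := exists_approximating_sequence
    (D := compactClosure C α) isCocompletePreaisle_preaisle transfiniteClosure_le_preaisle
    -- A map to an object of `S` factors through that object itself, since `S` is contained in
    -- `S(α)`.
    (fun y hy => hy _ hfac fun s hs k _ u =>
      ⟨s, u, 𝟙 s, le_transfiniteClosure hα.aleph0_le _ hs, Category.comp_id u⟩) hx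
  refine ⟨X, f, hX, isHomotopyColimit_of_approximating_sequence hD (fun d hd => ?_) X f p hfp hp hf⟩
  obtain ⟨G, -, hG, hgen⟩ := hC
  exact hgen d fun g hg n u => hd _ (.shift _ _ (.of _ (hG _ hg))) u
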